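/- Let $G$ be a second countable locally compact (Hausdorff) group with right Haar measure $\lambda$. Let $\Phi:\mathbb R\to\mathbb R$ be a Young function, that is, a continuous, even, convex function with $\Phi(0)=0$, $\Phi(t)>0$ for $t>0$ and $\lim_{t\to\infty}\Phi(t)=\infty$, and suppose that $\Phi$ is $\Delta_2$-regular: there are $M>0$ and $t_0>0$ with $\Phi(2t)\le M\Phi(t)$ for all $t\ge t_0$ if $G$ is compact, and there is $M>0$ with $\Phi(2t)\le M\Phi(t)$ for all $t>0$ if $G$ is not compact. Let $$L^\Phi(G)=\Big\{f:G\to\mathbb C \text{ Borel measurable}:\ \int_G\Phi(\alpha|f|)\,d\lambda<\infty\text{ for some }\alpha>0\Big\}$$ (functions that agree $\lambda$-almost everywhere being identified), with the Luxemburg norm $N_\Phi(f)=\inf\{k>0:\int_G\Phi(|f|/k)\,d\lambda\le1\}$. Let $a\in G$ be aperiodic, i.e. the closed subgroup of $G$ generated by $a$ is not compact. Let $w:G\to(0,\infty)$ be a weight, i.e. a bounded continuous function, and assume $w^{-1}\in L^\infty(G)$. Let $T_{a,w}:L^\Phi(G)\to L^\Phi(G)$ be the weighted translation $(T_{a,w}f)(x)=w(x)f(xa^{-1})$.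 For $n\in\mathbb N$ and $x\in G$ put $$\varphi_n(x)=\prod_{j=1}^{n}w(xa^{j}),\qquad \widetilde\varphi_n(x)=\Big(\prod_{j=0}^{n-1}w(xa^{-j})\Big)^{-1}.$$ Then the following conditions are equivalent. (i) $T_{a,w}$ is topologically mixing on $L^\Phi(G)$: for all nonempty open sets $U,V\subset L^\Phi(G)$ there is $N$ such that $T_{a,w}^nU\cap V\ne\emptyset$ for all $n\ge N$. (ii) For each compact set $K\subset G$ with $\lambda(K)>0$ there is a sequence of Borel sets $E_n\subset K$ such that $\lim_{n\to\infty}\lambda(E_n)=\lambda(K)$ and $$\lim_{n\to\infty}\ \sup_{x\in E_n}\varphi_n(x)=\lim_{n\to\infty}\ \sup_{x\in E_n}\widetilde\varphi_n(x)=0,$$ where the supremum over the empty set is $0$. -/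

import Mathlib

open MeasureTheory Filter Topology
open scoped ENNReal

/-- A Young function: a continuous, even, convex function `Φ : ℝ → ℝ` with `Φ 0 = 0`,
`Φ t > 0` for `t > 0` and `Φ t → ∞` as `t → ∞`. -/
structure YoungFunction where
  toFun : ℝ → ℝ
  continuous_toFun : Continuous toFun
  even_toFun : ∀ t, toFun (-t) = toFun t
  convexOn_toFun : ConvexOn ℝ Set.univ toFun
  map_zero' : toFun 0 = 0
  pos_of_pos' : ∀ t, 0 < t → 0 < toFun t
  tendsto_atTop' : Tendsto toFun atTop atTop

namespace YoungFunction

instance : CoeFun YoungFunction (fun _ => ℝ → ℝ) := ⟨YoungFunction.toFun⟩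

/-- `Δ₂`-regularity of a Young function relative to `G`: `Φ (2 t) ≤ M Φ t` for all large `t`
if `G` is compact, and for all `t > 0` if `G` is not compact. -/
def IsDelta2Regular (Φ : YoungFunction) (G : Type*) [TopologicalSpace G] : Prop :=
  (CompactSpace G → ∃ M > (0 : ℝ), ∃ t₀ > (0 : ℝ), ∀ t ≥ t₀, Φ (2 * t) ≤ M * Φ t) ∧
  (¬ CompactSpace G → ∃ M > (0 : ℝ), ∀ t > (0 : ℝ), Φ (2 * t) ≤ M * Φ t)

theorem nonneg (Φ : YoungFunction) (t : ℝ) : 0 ≤ Φ t := by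
  rcases lt_trichotomy t 0 with h | h | h
  · have := Φ.pos_of_pos' (-t) (by linarith)
    rw [Φ.even_toFun] at this
    exact this.le
  · rw [h, Φ.map_zero']
  · exact (Φ.pos_of_pos' t h).le

theorem map_mul_le (Φ : YoungFunction) {s : ℝ} (hs0 : 0 ≤ s) (hs1 : s ≤ 1) (t : ℝ) :
    Φ (s * t) ≤ s * Φ t := by
  have h := Φ.convexOn_toFun.2 (Set.mem_univ t) (Set.mem_univ 0) hs0
    (sub_nonneg.2 hs1) (by ring)
  simpa [Φ.map_zero'] using h

theorem mono (Φ : YoungFunction) {s t : ℝ} (hs : 0 ≤ s) (hst : s ≤ t) : Φ s ≤ Φ t := by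
  rcases hs.eq_or_lt with rfl | hs'
  · rw [Φ.map_zero']; exact Φ.nonneg t
  · have ht : 0 < t := hs'.trans_le hst
    have h1 : s / t ≤ 1 := (div_le_one ht).2 hst
    have h := Φ.map_mul_le (div_nonneg hs ht.le) h1 t
    rw [div_mul_cancel₀ _ ht.ne'] at h
    exact h.trans (mul_le_of_le_one_left (Φ.nonneg t) h1)

end YoungFunction

section Orlicz

variable {α : Type*} [MeasurableSpace α]

/-- The modular `∫ Φ(|f|) dμ`, with values in `[0, ∞]`. -/
noncomputable def orliczModular (Φ : YoungFunction) (μ : Measure α) (f : α → ℂ) : ℝ≥0∞ :=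
  ∫⁻ x, ENNReal.ofReal (Φ ‖f x‖) ∂μ

/-- Real numbers `k > 0` with `∫ Φ(|f| / k) dμ ≤ 1`. -/
def luxemburgSet (Φ : YoungFunction) (μ : Measure α) (f : α → ℂ) : Set ℝ :=
  {k : ℝ | 0 < k ∧ ∫⁻ x, ENNReal.ofReal (Φ (‖f x‖ / k)) ∂μ ≤ 1}

/-- The Luxemburg norm `N_Φ(f) = inf {k > 0 : ∫ Φ(|f| / k) dμ ≤ 1}`. -/
noncomputable def luxemburgNorm (Φ : YoungFunction) (μ : Measure α) (f : α → ℂ) : ℝ :=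
  sInf (luxemburgSet Φ μ f)

/-- `∫ Φ(c |f|) dμ < ∞` for some `c > 0`. -/
def MemOrlicz (Φ : YoungFunction) (μ : Measure α) (f : α → ℂ) : Prop :=
  ∃ c : ℝ, 0 < c ∧ ∫⁻ x, ENNReal.ofReal (Φ (c * ‖f x‖)) ∂μ < ∞

variable {Φ : YoungFunction} {μ : Measure α}

theorem luxemburgSet_bddBelow (f : α → ℂ) : BddBelow (luxemburgSet Φ μ f) :=
  ⟨0, fun _ hk => hk.1.le⟩

theorem luxemburgNorm_nonneg (f : α → ℂ) : 0 ≤ luxemburgNorm Φ μ f :=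
  Real.sInf_nonneg fun _ hk => hk.1.le

theorem luxemburgSet_mono {f : α → ℂ} {k l : ℝ} (hk : k ∈ luxemburgSet Φ μ f) (hkl : k ≤ l) :
    l ∈ luxemburgSet Φ μ f := by
  refine ⟨hk.1.trans_le hkl, le_trans (lintegral_mono fun x => ?_) hk.2⟩
  have := hk.1
  exact ENNReal.ofReal_le_ofReal (Φ.mono (div_nonneg (norm_nonneg _) (hk.1.trans_le hkl).le)
    (by gcongr))

theorem lintegral_young_mul_le (f : α → ℂ) {s : ℝ} (hs0 : 0 ≤ s) (hs1 : s ≤ 1) (c : ℝ) :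
    ∫⁻ x, ENNReal.ofReal (Φ (s * (c * ‖f x‖))) ∂μ ≤
      ENNReal.ofReal s * ∫⁻ x, ENNReal.ofReal (Φ (c * ‖f x‖)) ∂μ := by
  rw [← lintegral_const_mul' _ _ ENNReal.ofReal_ne_top]
  refine lintegral_mono fun x => ?_
  rw [← ENNReal.ofReal_mul hs0]
  exact ENNReal.ofReal_le_ofReal (Φ.map_mul_le hs0 hs1 _)

theorem memOrlicz_iff_nonempty (f : α → ℂ) :
    MemOrlicz Φ μ f ↔ (luxemburgSet Φ μ f).Nonempty := by
  constructor
  · rintro ⟨c, hc, hf⟩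
    set I := ∫⁻ x, ENNReal.ofReal (Φ (c * ‖f x‖)) ∂μ with hI
    set m : ℝ := I.toReal + 1 with hm
    have hI0 : 0 ≤ I.toReal := ENNReal.toReal_nonneg
    have hm0 : 0 < m := by linarith
    refine ⟨m / c, div_pos hm0 hc, ?_⟩
    have h := lintegral_young_mul_le (Φ := Φ) (μ := μ) f (s := m⁻¹) (inv_nonneg.2 hm0.le)
      (inv_le_one_of_one_le₀ (by linarith)) c
    have e : ∀ x, ‖f x‖ / (m / c) = m⁻¹ * (c * ‖f x‖) := fun x => by field_simp
    simp_rw [e]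
    refine h.trans ?_
    rw [← hI, ← ENNReal.ofReal_toReal hf.ne, ← ENNReal.ofReal_mul (inv_nonneg.2 hm0.le)]
    refine ENNReal.ofReal_le_one.2 ?_
    rw [inv_mul_le_iff₀ hm0]
    linarith
  · rintro ⟨k, hk, hf⟩
    refine ⟨k⁻¹, inv_pos.2 hk, lt_of_le_of_lt ?_ ENNReal.one_lt_top⟩
    simpa [div_eq_inv_mul] using hf

theorem luxemburgNorm_congr {f g : α → ℂ} (h : ∀ᵐ x ∂μ, ‖f x‖ = ‖g x‖) :
    luxemburgNorm Φ μ f = luxemburgNorm Φ μ g := by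
  have : luxemburgSet Φ μ f = luxemburgSet Φ μ g := by
    ext k
    have e : ∫⁻ x, ENNReal.ofReal (Φ (‖f x‖ / k)) ∂μ = ∫⁻ x, ENNReal.ofReal (Φ (‖g x‖ / k)) ∂μ :=
      lintegral_congr_ae (h.mono fun x hx => by simp only [hx])
    simp only [luxemburgSet, Set.mem_ofPred_eq, e]
  rw [luxemburgNorm, luxemburgNorm, this]

theorem MemOrlicz.of_norm_le {f g : α → ℂ} (hg : MemOrlicz Φ μ g)
    (h : ∀ᵐ x ∂μ, ‖f x‖ ≤ ‖g x‖) : MemOrlicz Φ μ f := by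
  obtain ⟨c, hc, hI⟩ := hg
  refine ⟨c, hc, lt_of_le_of_lt (lintegral_mono_ae (h.mono fun x hx => ?_)) hI⟩
  exact ENNReal.ofReal_le_ofReal (Φ.mono (by positivity) (by gcongr))

theorem memOrlicz_zero : MemOrlicz Φ μ (fun _ => 0) :=
  ⟨1, one_pos, by simp [Φ.map_zero']⟩

theorem smul_mem_luxemburgSet {f : α → ℂ} {k : ℝ} (hk : k ∈ luxemburgSet Φ μ f) {c : ℂ}
    (hc : c ≠ 0) : ‖c‖ * k ∈ luxemburgSet Φ μ (fun x => c * f x) := by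
  have hc' : 0 < ‖c‖ := norm_pos_iff.2 hc
  refine ⟨mul_pos hc' hk.1, ?_⟩
  have e : ∀ x, ‖c * f x‖ / (‖c‖ * k) = ‖f x‖ / k := fun x => by
    rw [norm_mul, mul_div_mul_left _ _ hc'.ne']
  simp_rw [e]
  exact hk.2

theorem MemOrlicz.const_mul {f : α → ℂ} (hf : MemOrlicz Φ μ f) (c : ℂ) :
    MemOrlicz Φ μ (fun x => c * f x) := by
  rcases eq_or_ne c 0 with rfl | hc
  · simpa using memOrlicz_zero (Φ := Φ) (μ := μ)
  · rw [memOrlicz_iff_nonempty] at hf ⊢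
    obtain ⟨k, hk⟩ := hf
    exact ⟨_, smul_mem_luxemburgSet hk hc⟩

theorem add_mem_luxemburgSet {f g : α → ℂ} (hf : AEStronglyMeasurable f μ) {k l : ℝ}
    (hk : k ∈ luxemburgSet Φ μ f) (hl : l ∈ luxemburgSet Φ μ g) :
    k + l ∈ luxemburgSet Φ μ (fun x => f x + g x) := by
  obtain ⟨hk0, hkI⟩ := hk
  obtain ⟨hl0, hlI⟩ := hl
  have hkl : 0 < k + l := add_pos hk0 hl0
  have hs0 : 0 ≤ k / (k + l) := by positivity
  have ht0 : 0 ≤ l / (k + l) := by positivity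
  have hst : k / (k + l) + l / (k + l) = 1 := by field_simp
  refine ⟨hkl, ?_⟩
  have hmeas : AEMeasurable (fun x => ENNReal.ofReal (k / (k + l)) *
      ENNReal.ofReal (Φ (‖f x‖ / k))) μ := by
    have h1 : AEMeasurable (fun x => ‖f x‖ / k) μ := hf.norm.aemeasurable.div_const k
    exact (ENNReal.measurable_ofReal.comp_aemeasurable
      (Φ.continuous_toFun.measurable.comp_aemeasurable h1)).const_mul _
  calc ∫⁻ x, ENNReal.ofReal (Φ (‖f x + g x‖ / (k + l))) ∂μ
      ≤ ∫⁻ x, (ENNReal.ofReal (k / (k + l)) * ENNReal.ofReal (Φ (‖f x‖ / k)) +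
          ENNReal.ofReal (l / (k + l)) * ENNReal.ofReal (Φ (‖g x‖ / l))) ∂μ := by
        refine lintegral_mono fun x => ?_
        rw [← ENNReal.ofReal_mul hs0, ← ENNReal.ofReal_mul ht0, ← ENNReal.ofReal_add
          (mul_nonneg hs0 (Φ.nonneg _)) (mul_nonneg ht0 (Φ.nonneg _))]
        refine ENNReal.ofReal_le_ofReal ?_
        have hc := Φ.convexOn_toFun.2 (Set.mem_univ (‖f x‖ / k)) (Set.mem_univ (‖g x‖ / l))
          hs0 ht0 hst
        simp only [smul_eq_mul] at hc
        refine le_trans (Φ.mono (by positivity) ?_) hc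
        have e : k / (k + l) * (‖f x‖ / k) + l / (k + l) * (‖g x‖ / l)
            = (‖f x‖ + ‖g x‖) / (k + l) := by field_simp
        rw [e]
        gcongr
        exact norm_add_le _ _
    _ = ENNReal.ofReal (k / (k + l)) * ∫⁻ x, ENNReal.ofReal (Φ (‖f x‖ / k)) ∂μ +
          ENNReal.ofReal (l / (k + l)) * ∫⁻ x, ENNReal.ofReal (Φ (‖g x‖ / l)) ∂μ := by
        rw [lintegral_add_left' hmeas, lintegral_const_mul' _ _ ENNReal.ofReal_ne_top,
          lintegral_const_mul' _ _ ENNReal.ofReal_ne_top]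
    _ ≤ ENNReal.ofReal (k / (k + l)) * 1 + ENNReal.ofReal (l / (k + l)) * 1 := by gcongr
    _ = 1 := by
        rw [mul_one, mul_one, ← ENNReal.ofReal_add hs0 ht0, hst, ENNReal.ofReal_one]

theorem MemOrlicz.add {f g : α → ℂ} (hfm : AEStronglyMeasurable f μ) (hf : MemOrlicz Φ μ f)
    (hg : MemOrlicz Φ μ g) : MemOrlicz Φ μ (fun x => f x + g x) := by
  rw [memOrlicz_iff_nonempty] at *
  obtain ⟨k, hk⟩ := hf
  obtain ⟨l, hl⟩ := hg
  exact ⟨_, add_mem_luxemburgSet hfm hk hl⟩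

theorem luxemburgNorm_add_le {f g : α → ℂ} (hfm : AEStronglyMeasurable f μ)
    (hf : MemOrlicz Φ μ f) (hg : MemOrlicz Φ μ g) :
    luxemburgNorm Φ μ (fun x => f x + g x) ≤ luxemburgNorm Φ μ f + luxemburgNorm Φ μ g := by
  rw [memOrlicz_iff_nonempty] at hf hg
  refine le_of_forall_pos_le_add fun ε hε => ?_
  obtain ⟨k, hk, hk'⟩ := Real.lt_sInf_add_pos hf (half_pos hε)
  obtain ⟨l, hl, hl'⟩ := Real.lt_sInf_add_pos hg (half_pos hε)
  have := csInf_le (luxemburgSet_bddBelow _) (add_mem_luxemburgSet hfm hk hl)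
  simp only [luxemburgNorm]
  linarith

theorem luxemburgNorm_zero : luxemburgNorm Φ μ (fun _ => 0) = 0 := by
  refine le_antisymm (le_of_forall_pos_le_add fun ε hε => ?_) (luxemburgNorm_nonneg _)
  rw [zero_add]
  exact csInf_le (luxemburgSet_bddBelow _) ⟨hε, by simp [Φ.map_zero']⟩

theorem luxemburgNorm_const_mul {f : α → ℂ} (hf : MemOrlicz Φ μ f) (c : ℂ) :
    luxemburgNorm Φ μ (fun x => c * f x) = ‖c‖ * luxemburgNorm Φ μ f := by
  have key : ∀ {h : α → ℂ} {b : ℂ}, b ≠ 0 → MemOrlicz Φ μ h →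
      luxemburgNorm Φ μ (fun x => b * h x) ≤ ‖b‖ * luxemburgNorm Φ μ h := by
    intro h b hb hh
    rw [memOrlicz_iff_nonempty] at hh
    have hb' : 0 < ‖b‖ := norm_pos_iff.2 hb
    rw [← div_le_iff₀' hb']
    refine le_csInf hh fun k hk => ?_
    rw [div_le_iff₀' hb']
    exact csInf_le (luxemburgSet_bddBelow _) (smul_mem_luxemburgSet hk hb)
  rcases eq_or_ne c 0 with rfl | hc
  · simpa using luxemburgNorm_zero (Φ := Φ) (μ := μ)
  · refine le_antisymm (key hc hf) ?_
    have h := key (inv_ne_zero hc) (hf.const_mul c)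
    simp only [inv_mul_cancel_left₀ hc, norm_inv] at h
    rwa [le_inv_mul_iff₀ (norm_pos_iff.2 hc)] at h

theorem ae_eq_zero_of_luxemburgNorm_eq_zero {f : α → ℂ} (hfm : AEStronglyMeasurable f μ)
    (hf : MemOrlicz Φ μ f) (h0 : luxemburgNorm Φ μ f = 0) : ∀ᵐ x ∂μ, f x = 0 := by
  rw [memOrlicz_iff_nonempty] at hf
  have hmem : ∀ k : ℝ, 0 < k → k ∈ luxemburgSet Φ μ f := fun k hk => by
    obtain ⟨l, hl, hlk⟩ := exists_lt_of_csInf_lt hf (show sInf (luxemburgSet Φ μ f) < k by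
      rw [← luxemburgNorm, h0]; exact hk)
    exact luxemburgSet_mono hl hlk.le
  have hI : ∫⁻ x, ENNReal.ofReal (Φ ‖f x‖) ∂μ = 0 := by
    refine le_antisymm (ENNReal.le_of_forall_pos_le_add fun ε hε _ => ?_) zero_le
    rw [zero_add]
    set s : ℝ := min 1 ε with hs
    have hs0 : 0 < s := lt_min one_pos (by exact_mod_cast hε)
    have h := lintegral_young_mul_le (Φ := Φ) (μ := μ) f hs0.le (min_le_left _ _) s⁻¹
    simp only [mul_inv_cancel_left₀ hs0.ne'] at h
    have h2 := (hmem s hs0).2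
    simp only [div_eq_inv_mul] at h2
    calc ∫⁻ x, ENNReal.ofReal (Φ ‖f x‖) ∂μ ≤ ENNReal.ofReal s * 1 := h.trans (by gcongr)
      _ ≤ ε := by
        rw [mul_one]
        refine (ENNReal.ofReal_le_ofReal (min_le_right _ _)).trans ?_
        simp
  have hmeas : AEMeasurable (fun x => ENNReal.ofReal (Φ ‖f x‖)) μ :=
    ENNReal.measurable_ofReal.comp_aemeasurable
      (Φ.continuous_toFun.measurable.comp_aemeasurable hfm.norm.aemeasurable)
  rw [lintegral_eq_zero_iff' hmeas] at hI
  filter_upwards [hI] with x hx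
  by_contra hne
  have := Φ.pos_of_pos' _ (norm_pos_iff.2 hne)
  simp only [Pi.zero_apply, ENNReal.ofReal_eq_zero] at hx
  linarith

variable (Φ μ) in
/-- The Orlicz space `L^Φ(μ)`: (classes modulo a.e. equality of) measurable functions
`f : α → ℂ` with `∫ Φ(c |f|) dμ < ∞` for some `c > 0`. -/
def OrliczSpace : Submodule ℂ (α →ₘ[μ] ℂ) where
  carrier := {f | MemOrlicz Φ μ f}
  zero_mem' := memOrlicz_zero.of_norm_le <|
    (AEEqFun.coeFn_zero (α := α) (μ := μ) (β := ℂ)).mono fun x hx => by simp [hx]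
  add_mem' := fun {f g} hf hg => (MemOrlicz.add f.aestronglyMeasurable hf hg).of_norm_le <|
    (AEEqFun.coeFn_add f g).mono fun x hx => by simp [hx]
  smul_mem' := fun c f hf => (MemOrlicz.const_mul hf c).of_norm_le <|
    (AEEqFun.coeFn_smul c f).mono fun x hx => by simp [hx]

noncomputable instance OrliczSpace.instNorm : Norm (OrliczSpace Φ μ) :=
  ⟨fun f => luxemburgNorm Φ μ (f : α →ₘ[μ] ℂ)⟩

theorem OrliczSpace.norm_def (f : OrliczSpace Φ μ) :
    ‖f‖ = luxemburgNorm Φ μ (f : α →ₘ[μ] ℂ) := rfl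

theorem OrliczSpace.normCore : NormedSpace.Core ℂ (OrliczSpace Φ μ) where
  norm_nonneg f := luxemburgNorm_nonneg _
  norm_smul c f := by
    rw [norm_def, norm_def, ← luxemburgNorm_const_mul f.2 c]
    exact luxemburgNorm_congr <|
      (AEEqFun.coeFn_smul c (f : α →ₘ[μ] ℂ)).mono fun x hx => by simp [hx]
  norm_triangle f g := by
    rw [norm_def, norm_def, norm_def]
    refine le_of_eq_of_le (luxemburgNorm_congr ?_)
      (luxemburgNorm_add_le (f : α →ₘ[μ] ℂ).aestronglyMeasurable f.2 g.2)
    exact (AEEqFun.coeFn_add (f : α →ₘ[μ] ℂ) (g : α →ₘ[μ] ℂ)).mono fun x hx => by simp [hx]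
  norm_eq_zero_iff f := by
    constructor
    · intro h
      refine Subtype.ext (AEEqFun.ext ?_)
      filter_upwards [ae_eq_zero_of_luxemburgNorm_eq_zero
        (f : α →ₘ[μ] ℂ).aestronglyMeasurable f.2 h, AEEqFun.coeFn_zero (α := α) (μ := μ) (β := ℂ)]
        with x hx hx0
      simpa [hx] using hx0.symm
    · rintro rfl
      rw [norm_def, ← luxemburgNorm_zero (Φ := Φ) (μ := μ)]
      exact luxemburgNorm_congr <|
        (AEEqFun.coeFn_zero (α := α) (μ := μ) (β := ℂ)).mono fun x hx => by simp [hx]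

/-- `L^Φ(μ)` carries the topology of the Luxemburg norm. -/
noncomputable instance OrliczSpace.instNormedAddCommGroup :
    NormedAddCommGroup (OrliczSpace Φ μ) :=
  NormedAddCommGroup.ofCore OrliczSpace.normCore

noncomputable instance OrliczSpace.instNormedSpace : NormedSpace ℂ (OrliczSpace Φ μ) :=
  NormedSpace.ofCore OrliczSpace.normCore

end Orlicz

/-- A self-map `T` of a topological space is topologically mixing if for all nonempty open `U`, `V`, one has `T^n U ∩ V ≠ ∅` from some `n`
onwards. -/
def IsTopologicallyMixing {X : Type*} [TopologicalSpace X] (T : X → X) : Prop :=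
  ∀ U V : Set X, IsOpen U → U.Nonempty → IsOpen V → V.Nonempty →
    ∃ N : ℕ, ∀ n ≥ N, ((T^[n] '' U) ∩ V).Nonempty

section Group

variable {G : Type*} [Group G]

/-- The convolution with a point mass, `(f * δ_b)(x) = ∫ f(x y⁻¹) dδ_b(y) = f(x b⁻¹)`. -/
def convDirac {β : Type*} (f : G → β) (b : G) : G → β := fun x => f (x * b⁻¹)

/-- `a` is aperiodic if the closed subgroup generated by `a` is not compact. -/
def IsAperiodic [TopologicalSpace G] [IsTopologicalGroup G] (a : G) : Prop :=
  ¬ IsCompact ((Subgroup.zpowers a).topologicalClosure : Set G)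

/-- A weight on `G`: a bounded continuous function `w : G → (0, ∞)`. -/
structure GroupWeight (G : Type*) [TopologicalSpace G] where
  toFun : G → ℝ
  continuous_toFun : Continuous toFun
  pos' : ∀ x, 0 < toFun x
  bddAbove' : BddAbove (Set.range toFun)

instance [TopologicalSpace G] : CoeFun (GroupWeight G) (fun _ => G → ℝ) := ⟨GroupWeight.toFun⟩

/-- `φ_n = ∏_{j=1}^n w * δ_{a⁻¹}^j`, i.e. `φ_n(x) = ∏_{j=1}^n w(x a^j)`. -/
def weightProd (w : G → ℝ) (a : G) (n : ℕ) (x : G) : ℝ :=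
  ∏ j ∈ Finset.Icc 1 n, convDirac w (a⁻¹ ^ j) x

/-- `φ̃_n = (∏_{j=0}^{n-1} w * δ_a^j)⁻¹`, i.e. `φ̃_n(x) = (∏_{j=0}^{n-1} w(x a^{-j}))⁻¹`. -/
noncomputable def weightProdInv (w : G → ℝ) (a : G) (n : ℕ) (x : G) : ℝ :=
  (∏ j ∈ Finset.range n, convDirac w (a ^ j) x)⁻¹

/-- The norm `‖h|_E‖_∞ = sup_{x ∈ E} |h(x)|` of a restriction, with values in `[0, ∞]`. -/
noncomputable def supNormOn {X : Type*} (h : X → ℝ) (E : Set X) : ℝ≥0∞ :=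
  ⨆ x ∈ E, ‖h x‖ₑ

variable [TopologicalSpace G] [IsTopologicalGroup G]
  [MeasurableSpace G] [BorelSpace G]

/-- `w · (f * δ_a)` on classes modulo a.e. equality. -/
noncomputable def weightedTranslationAEEqFun (lam : Measure G) [lam.IsMulRightInvariant]
    (a : G) (w : GroupWeight G) (f : G →ₘ[lam] ℂ) : G →ₘ[lam] ℂ :=
  AEEqFun.mk (fun x => (w x : ℂ))
      (Complex.continuous_ofReal.comp w.continuous_toFun).aestronglyMeasurable *
    f.compMeasurePreserving (fun x => x * a⁻¹) (measurePreserving_mul_right lam a⁻¹)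

theorem coeFn_weightedTranslationAEEqFun (lam : Measure G) [lam.IsMulRightInvariant]
    (a : G) (w : GroupWeight G) (f : G →ₘ[lam] ℂ) :
    weightedTranslationAEEqFun lam a w f =ᵐ[lam] fun x => (w x : ℂ) * convDirac f a x := by
  refine (AEEqFun.coeFn_mul _ _).trans ?_
  exact (AEEqFun.coeFn_mk _ _).mul
    (AEEqFun.coeFn_compMeasurePreserving f (measurePreserving_mul_right lam a⁻¹))

theorem weightedTranslationAEEqFun_mem (Φ : YoungFunction) (lam : Measure G)
    [lam.IsMulRightInvariant] (a : G) (w : GroupWeight G) {f : G →ₘ[lam] ℂ}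
    (hf : f ∈ OrliczSpace Φ lam) :
    weightedTranslationAEEqFun lam a w f ∈ OrliczSpace Φ lam := by
  obtain ⟨C, hC⟩ := w.bddAbove'
  have hC' : ∀ x, w x ≤ C := fun x => hC ⟨x, rfl⟩
  have h1 : MemOrlicz Φ lam (convDirac f a) := by
    obtain ⟨c, hc, hI⟩ := hf
    refine ⟨c, hc, ?_⟩
    have := lintegral_mul_right_eq_self (μ := lam)
      (fun x => ENNReal.ofReal (Φ (c * ‖f x‖))) a⁻¹
    exact this.trans_lt hI
  refine (h1.const_mul (C : ℂ)).of_norm_le ?_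
  filter_upwards [coeFn_weightedTranslationAEEqFun lam a w f] with x hx
  rw [hx, norm_mul, norm_mul, Complex.norm_real, Complex.norm_real, Real.norm_eq_abs,
    Real.norm_eq_abs, abs_of_pos (w.pos' x)]
  gcongr
  exact (hC' x).trans (le_abs_self C)

theorem weightedTranslationAEEqFun_add (lam : Measure G) [lam.IsMulRightInvariant]
    (a : G) (w : GroupWeight G) (f g : G →ₘ[lam] ℂ) :
    weightedTranslationAEEqFun lam a w (f + g) =
      weightedTranslationAEEqFun lam a w f + weightedTranslationAEEqFun lam a w g := by
  induction f using AEEqFun.induction_on with | _ f hf => ?_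
  induction g using AEEqFun.induction_on with | _ g hg => ?_
  exact AEEqFun.mk_eq_mk.2 (Eventually.of_forall fun x => mul_add (w x : ℂ) _ _)

theorem weightedTranslationAEEqFun_smul (lam : Measure G) [lam.IsMulRightInvariant]
    (a : G) (w : GroupWeight G) (c : ℂ) (f : G →ₘ[lam] ℂ) :
    weightedTranslationAEEqFun lam a w (c • f) = c • weightedTranslationAEEqFun lam a w f := by
  induction f using AEEqFun.induction_on with | _ f hf => ?_
  exact AEEqFun.mk_eq_mk.2 (Eventually.of_forall fun x => mul_left_comm (w x : ℂ) _ _)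

/-- The weighted translation `T_{a,w} f = w · (f * δ_a)` on `L^Φ(G)`. -/
noncomputable def weightedTranslation (Φ : YoungFunction) (lam : Measure G)
    [lam.IsMulRightInvariant] (a : G) (w : GroupWeight G) :
    OrliczSpace Φ lam →ₗ[ℂ] OrliczSpace Φ lam where
  toFun f := ⟨weightedTranslationAEEqFun lam a w f, weightedTranslationAEEqFun_mem Φ lam a w f.2⟩
  map_add' f g := Subtype.ext (weightedTranslationAEEqFun_add lam a w f g)
  map_smul' c f := Subtype.ext (weightedTranslationAEEqFun_smul lam a w c f)

end Group

/-! The iterate is explicit: `T^n f (x) = φ̃_n(x)⁻¹ f(x a⁻ⁿ)`. Right translations preserve the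
Luxemburg norm, so after a shift by `a^n` the iterate acts as multiplication by `φ_n`, and its
inverse acts as multiplication by `φ̃_n` followed by a shift. The condition on the sets `E n` says
that both multipliers are uniformly small on almost all of `K`.

Necessity: mixing is applied to a neighbourhood of the indicator of `K` and a neighbourhood of `0`,
once in each order. Chebyshev's inequality turns closeness in norm into closeness in measure
(`exists_nhds_indicator`, `exists_nhds_zero`). Comparing `u` with `T^n u` then shows that, for large
`n`, `φ_n` and `φ̃_n` exceed a given `δ` only on a small part of `K`. A diagonal choice of
thresholds yields the sets `E n`.

Sufficiency: `Δ₂`-regularity makes bounded compactly supported functions dense, so the two open sets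
may be represented by such `f` and `g`. Let `u` be `f` cut down to `E n`, and let `v` be the
preimage under `T^n` of `g` cut down to `E n`. Then `u + v` is close to `f` because `v` is small,
and `T^n (u + v)` is close to `g` because `T^n u` is small. -/

theorem Filter.exists_tendsto_of_forall_eventually {P : ℕ → ℕ → Prop}
    (h : ∀ m, ∀ᶠ n in atTop, P n m) :
    ∃ k : ℕ → ℕ, Tendsto k atTop atTop ∧ ∀ᶠ n in atTop, P n (k n) := by
  classical
  -- Diagonal choice: the largest `m ≤ n` for which `P n m` holds.
  refine ⟨fun n => Nat.findGreatest (P n) n, tendsto_atTop.2 fun m => ?_, ?_⟩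
  · filter_upwards [h m, eventually_ge_atTop m] with n hn hmn
    exact Nat.le_findGreatest hmn hn
  -- `Nat.findGreatest` defaults to `0` when no index works, so the case `m = 0` guarantees that the
  -- chosen index is a genuine one.
  · filter_upwards [h 0] with n hn
    exact Nat.findGreatest_spec (Nat.zero_le n) hn

/-! ### Luxemburg norm estimates and convergence in measure -/

section OrliczLemmas

variable {α : Type*} [MeasurableSpace α] {Φ : YoungFunction} {μ : Measure α}

theorem luxemburgNorm_le_of_lintegral_le {f : α → ℂ} {k : ℝ} (hk : 0 < k)
    (h : ∫⁻ x, ENNReal.ofReal (Φ (‖f x‖ / k)) ∂μ ≤ 1) : luxemburgNorm Φ μ f ≤ k :=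
  csInf_le (luxemburgSet_bddBelow _) ⟨hk, h⟩

/-- The admissible constants form an upward closed set, so the strict inequality makes it irrelevant
whether the infimum is attained. -/
theorem lintegral_le_one_of_luxemburgNorm_lt {f : α → ℂ} (hf : MemOrlicz Φ μ f) {k : ℝ}
    (hk : luxemburgNorm Φ μ f < k) : ∫⁻ x, ENNReal.ofReal (Φ (‖f x‖ / k)) ∂μ ≤ 1 := by
  rw [memOrlicz_iff_nonempty] at hf
  obtain ⟨l, hl, hlk⟩ := exists_lt_of_csInf_lt hf hk
  exact (luxemburgSet_mono hl hlk.le).2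

theorem luxemburgNorm_mono {f g : α → ℂ} (hg : MemOrlicz Φ μ g)
    (h : ∀ᵐ x ∂μ, ‖f x‖ ≤ ‖g x‖) : luxemburgNorm Φ μ f ≤ luxemburgNorm Φ μ g := by
  rw [memOrlicz_iff_nonempty] at hg
  refine le_csInf hg fun k hk => ?_
  refine luxemburgNorm_le_of_lintegral_le hk.1 (le_trans (lintegral_mono_ae ?_) hk.2)
  filter_upwards [h] with x hx
  have := hk.1
  exact ENNReal.ofReal_le_ofReal (Φ.mono (by positivity) (by gcongr))

theorem luxemburgNorm_le_mul {f g : α → ℂ} (hg : MemOrlicz Φ μ g) {s : ℝ} (hs : 0 ≤ s)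
    (h : ∀ᵐ x ∂μ, ‖f x‖ ≤ s * ‖g x‖) : luxemburgNorm Φ μ f ≤ s * luxemburgNorm Φ μ g := by
  have h' := luxemburgNorm_const_mul hg (s : ℂ)
  rw [Complex.norm_real, Real.norm_of_nonneg hs] at h'
  rw [← h']
  refine luxemburgNorm_mono (hg.const_mul _) (h.mono fun x hx => ?_)
  rwa [norm_mul, Complex.norm_real, Real.norm_of_nonneg hs]

theorem YoungFunction.measurable_ofReal_comp (Φ : YoungFunction) {g : α → ℝ}
    (hg : AEMeasurable g μ) : AEMeasurable (fun x => ENNReal.ofReal (Φ (g x))) μ :=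
  ENNReal.measurable_ofReal.comp_aemeasurable
    (Φ.continuous_toFun.measurable.comp_aemeasurable hg)

/-- Chebyshev's inequality for the Luxemburg norm. -/
theorem measure_norm_ge_le {f : α → ℂ} (hfm : AEStronglyMeasurable f μ) (hf : MemOrlicz Φ μ f)
    {k δ : ℝ} (hδ : 0 < δ) (hk : luxemburgNorm Φ μ f < k) :
    μ {x | δ ≤ ‖f x‖} ≤ (ENNReal.ofReal (Φ (δ / k)))⁻¹ := by
  have hk0 : 0 < k := (luxemburgNorm_nonneg f).trans_lt hk
  have hpos : ENNReal.ofReal (Φ (δ / k)) ≠ 0 :=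
    (ENNReal.ofReal_pos.2 (Φ.pos_of_pos' _ (div_pos hδ hk0))).ne'
  have h1 := meas_ge_le_lintegral_div
    (Φ.measurable_ofReal_comp (hfm.norm.aemeasurable.div_const k)) hpos ENNReal.ofReal_ne_top
  refine (measure_mono fun x hx => ?_).trans (h1.trans ?_)
  · simp only [Set.mem_ofPred_eq] at hx ⊢
    exact ENNReal.ofReal_le_ofReal (Φ.mono (by positivity) (by gcongr))
  · rw [← one_div]
    gcongr
    exact lintegral_le_one_of_luxemburgNorm_lt hf hk

/-- Since `Φ` tends to infinity, a small enough radius `k` makes the Chebyshev bound as small as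
desired. -/
theorem YoungFunction.exists_inv_le (Φ : YoungFunction) {δ : ℝ} (hδ : 0 < δ) {η : ℝ≥0∞}
    (hη : 0 < η) : ∃ k > 0, (ENNReal.ofReal (Φ (δ / k)))⁻¹ ≤ η := by
  have h1 : Tendsto (fun t => (ENNReal.ofReal (Φ t))⁻¹) atTop (𝓝 0) := by
    rw [← ENNReal.inv_top]
    exact tendsto_inv_iff.2 (ENNReal.tendsto_ofReal_atTop.comp Φ.tendsto_atTop')
  obtain ⟨t, ht, ht0⟩ := ((h1.eventually (ge_mem_nhds hη)).and (eventually_gt_atTop 0)).exists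
  refine ⟨δ / t, div_pos hδ ht0, ?_⟩
  rwa [div_div_cancel₀ hδ.ne']

/-- A bounded function vanishing off `S` has modular controlled by the measure of `S`. -/
theorem lintegral_young_le_of_bound {f : α → ℂ} {C c : ℝ} (hc : 0 ≤ c) {S : Set α}
    (hS : MeasurableSet S) (hC : ∀ x, ‖f x‖ ≤ C) (h0 : ∀ x ∉ S, f x = 0) :
    ∫⁻ x, ENNReal.ofReal (Φ (c * ‖f x‖)) ∂μ ≤ ENNReal.ofReal (Φ (c * C)) * μ S := by
  rw [← lintegral_indicator_const hS]
  refine lintegral_mono fun x => ?_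
  by_cases hx : x ∈ S
  · rw [Set.indicator_of_mem hx]
    exact ENNReal.ofReal_le_ofReal (Φ.mono (by positivity) (by gcongr; exact hC x))
  · simp [h0 x hx, Φ.map_zero']

theorem memOrlicz_of_bound {f : α → ℂ} {C : ℝ} {S : Set α} (hS : MeasurableSet S)
    (hμ : μ S ≠ ∞) (hC : ∀ x, ‖f x‖ ≤ C) (h0 : ∀ x ∉ S, f x = 0) : MemOrlicz Φ μ f :=
  ⟨1, one_pos, (lintegral_young_le_of_bound zero_le_one hS hC h0).trans_lt
    (ENNReal.mul_lt_top ENNReal.ofReal_lt_top hμ.lt_top)⟩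

theorem luxemburgNorm_le_of_bound {f : α → ℂ} {C k : ℝ} (hk : 0 < k) {S : Set α}
    (hS : MeasurableSet S) (hC : ∀ x, ‖f x‖ ≤ C) (h0 : ∀ x ∉ S, f x = 0)
    (h : ENNReal.ofReal (Φ (k⁻¹ * C)) * μ S ≤ 1) : luxemburgNorm Φ μ f ≤ k := by
  refine luxemburgNorm_le_of_lintegral_le hk ?_
  simp only [div_eq_inv_mul]
  exact (lintegral_young_le_of_bound (inv_nonneg.2 hk.le) hS hC h0).trans h

/-- The element of `L^Φ(μ)` represented by a function. -/
noncomputable def OrliczSpace.mk (f : α → ℂ) (hf : AEStronglyMeasurable f μ)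
    (h : MemOrlicz Φ μ f) : OrliczSpace Φ μ :=
  ⟨AEEqFun.mk f hf, h.of_norm_le ((AEEqFun.coeFn_mk f hf).mono fun x hx => by rw [hx])⟩

theorem OrliczSpace.coeFn_mk (f : α → ℂ) (hf : AEStronglyMeasurable f μ)
    (h : MemOrlicz Φ μ f) : ((OrliczSpace.mk f hf h : OrliczSpace Φ μ) : α →ₘ[μ] ℂ) =ᵐ[μ] f :=
  AEEqFun.coeFn_mk f hf

theorem OrliczSpace.norm_eq_of_ae {u : OrliczSpace Φ μ} {f : α → ℂ}
    (h : (u : α →ₘ[μ] ℂ) =ᵐ[μ] f) : ‖u‖ = luxemburgNorm Φ μ f :=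
  luxemburgNorm_congr (h.mono fun x hx => by rw [hx])

theorem OrliczSpace.coeFn_sub_ae {u v : OrliczSpace Φ μ} {f g : α → ℂ}
    (hu : (u : α →ₘ[μ] ℂ) =ᵐ[μ] f) (hv : (v : α →ₘ[μ] ℂ) =ᵐ[μ] g) :
    ((u - v : OrliczSpace Φ μ) : α →ₘ[μ] ℂ) =ᵐ[μ] fun x => f x - g x :=
  (AEEqFun.coeFn_sub (u : α →ₘ[μ] ℂ) (v : α →ₘ[μ] ℂ)).trans (hu.sub hv)

/-- An element of `L^Φ` close to the indicator of `K` is at least `1/2` in norm on `K`, up to a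
set of small measure. -/
theorem exists_nhds_indicator (Φ : YoungFunction) {K : Set α} (hK : MeasurableSet K)
    (hμK : μ K ≠ ∞) {η : ℝ≥0∞} (hη : 0 < η) :
    ∃ U : Set (OrliczSpace Φ μ), IsOpen U ∧ U.Nonempty ∧
      ∀ u ∈ U, μ {x | x ∈ K ∧ ‖(u : α →ₘ[μ] ℂ) x‖ ≤ 1 / 2} ≤ η := by
  let f : α → ℂ := K.indicator 1
  have hfm : AEStronglyMeasurable f μ :=
    (stronglyMeasurable_one.indicator hK).aestronglyMeasurable
  have hf : MemOrlicz Φ μ f :=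
    memOrlicz_of_bound (C := 1) hK hμK
      (fun x => by by_cases hx : x ∈ K <;> simp [f, hx]) (fun x hx => by simp [f, hx])
  obtain ⟨k, hk, hkη⟩ := Φ.exists_inv_le (one_half_pos (α := ℝ)) hη
  refine ⟨Metric.ball (OrliczSpace.mk f hfm hf) k, Metric.isOpen_ball,
    ⟨_, Metric.mem_ball_self hk⟩, fun u hu => ?_⟩
  rw [mem_ball_iff_norm] at hu
  have hae := OrliczSpace.coeFn_sub_ae (EventuallyEq.refl _ ⇑(u : α →ₘ[μ] ℂ))
    (OrliczSpace.coeFn_mk f hfm hf)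
  -- On `K` the indicator is `1`, so `‖u x‖ ≤ 1/2` forces a difference of norm at least `1/2`: the
  -- exceptional set lies in a Chebyshev set.
  refine (measure_mono_ae ?_).trans ((measure_norm_ge_le
    (AEEqFun.aestronglyMeasurable _) (u - OrliczSpace.mk f hfm hf).2 one_half_pos hu).trans hkη)
  filter_upwards [hae] with x hx hxK
  obtain ⟨hxK, hux⟩ := hxK
  show 1 / 2 ≤ ‖_‖
  rw [hx]
  simp only [f, Set.indicator_of_mem hxK, Pi.one_apply]
  have := norm_sub_norm_le (1 : ℂ) ((u : α →ₘ[μ] ℂ) x)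
  rw [norm_sub_rev, norm_one] at this
  linarith

theorem exists_nhds_zero (Φ : YoungFunction) {η : ℝ≥0∞} (hη : 0 < η) {δ : ℝ} (hδ : 0 < δ) :
    ∃ V : Set (OrliczSpace Φ μ), IsOpen V ∧ V.Nonempty ∧
      ∀ u ∈ V, μ {x | δ ≤ ‖(u : α →ₘ[μ] ℂ) x‖} ≤ η := by
  obtain ⟨k, hk, hkη⟩ := Φ.exists_inv_le hδ hη
  refine ⟨Metric.ball 0 k, Metric.isOpen_ball, ⟨_, Metric.mem_ball_self hk⟩, fun u hu => ?_⟩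
  rw [mem_ball_zero_iff] at hu
  exact (measure_norm_ge_le (AEEqFun.aestronglyMeasurable _) u.2 hδ hu).trans hkη

end OrliczLemmas

/-! ### Consequences of `Δ₂`-regularity: finite modulars and density -/

section Density

variable {G : Type*} [TopologicalSpace G] [MeasurableSpace G] {Φ : YoungFunction}
  {lam : Measure G}

/-- `Δ₂` allows the scaling constant to be doubled without losing finiteness of the modular;
repeated doubling passes any given constant. -/
theorem YoungFunction.IsDelta2Regular.lintegral_lt_top [IsFiniteMeasureOnCompacts lam]
    (hΦ : Φ.IsDelta2Regular G) {f : G → ℂ} (hf : MemOrlicz Φ lam f) (c : ℝ) :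
    ∫⁻ x, ENNReal.ofReal (Φ (c * ‖f x‖)) ∂lam < ∞ := by
  have step : ∀ b : ℝ, 0 < b → ∫⁻ x, ENNReal.ofReal (Φ (b * ‖f x‖)) ∂lam < ∞ →
      ∫⁻ x, ENNReal.ofReal (Φ (2 * (b * ‖f x‖))) ∂lam < ∞ := by
    intro b hb hI
    by_cases hG : CompactSpace G
    · obtain ⟨M, hM, t₀, ht₀, h⟩ := hΦ.1 hG
      -- Where the argument is below `t₀` the doubling inequality is unavailable; there the
      -- integrand is at most `Φ (2 * t₀)`, a constant on a space of finite measure.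
      have hfin : lam Set.univ < ∞ := isCompact_univ.measure_lt_top
      calc ∫⁻ x, ENNReal.ofReal (Φ (2 * (b * ‖f x‖))) ∂lam
          ≤ ∫⁻ x, (ENNReal.ofReal M * ENNReal.ofReal (Φ (b * ‖f x‖)) +
              ENNReal.ofReal (Φ (2 * t₀))) ∂lam := by
            refine lintegral_mono fun x => ?_
            rcases le_total t₀ (b * ‖f x‖) with h1 | h1
            · rw [← ENNReal.ofReal_mul hM.le]
              exact (ENNReal.ofReal_le_ofReal (h _ h1)).trans le_self_add
            · exact (ENNReal.ofReal_le_ofReal (Φ.mono (by positivity) (by gcongr))).trans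
                le_add_self
        _ = ENNReal.ofReal M * ∫⁻ x, ENNReal.ofReal (Φ (b * ‖f x‖)) ∂lam +
              ENNReal.ofReal (Φ (2 * t₀)) * lam Set.univ := by
            rw [lintegral_add_right' _ aemeasurable_const,
              lintegral_const_mul' _ _ ENNReal.ofReal_ne_top, lintegral_const]
        _ < ∞ := ENNReal.add_lt_top.2 ⟨ENNReal.mul_lt_top ENNReal.ofReal_lt_top hI,
            ENNReal.mul_lt_top ENNReal.ofReal_lt_top hfin⟩
    · obtain ⟨M, hM, h⟩ := hΦ.2 hG
      calc ∫⁻ x, ENNReal.ofReal (Φ (2 * (b * ‖f x‖))) ∂lam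
          ≤ ∫⁻ x, ENNReal.ofReal M * ENNReal.ofReal (Φ (b * ‖f x‖)) ∂lam := by
            refine lintegral_mono fun x => ?_
            rw [← ENNReal.ofReal_mul hM.le]
            refine ENNReal.ofReal_le_ofReal ?_
            rcases (show 0 ≤ b * ‖f x‖ by positivity).eq_or_lt with h0 | h0
            · rw [← h0]; simp [Φ.map_zero']
            · exact h _ h0
        _ = ENNReal.ofReal M * ∫⁻ x, ENNReal.ofReal (Φ (b * ‖f x‖)) ∂lam :=
            lintegral_const_mul' _ _ ENNReal.ofReal_ne_top
        _ < ∞ := ENNReal.mul_lt_top ENNReal.ofReal_lt_top hI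
  obtain ⟨b, hb, hI⟩ := hf
  have pow : ∀ n : ℕ, ∫⁻ x, ENNReal.ofReal (Φ (2 ^ n * b * ‖f x‖)) ∂lam < ∞ := by
    intro n
    induction n with
    | zero => simpa using hI
    | succ n ih =>
      convert step (2 ^ n * b) (by positivity) ih using 5
      ring
  obtain ⟨n, hn⟩ := pow_unbounded_of_one_lt (|c| / b) (one_lt_two (α := ℝ))
  have hn' : |c| ≤ 2 ^ n * b := ((div_lt_iff₀ hb).1 hn).le
  refine lt_of_le_of_lt (lintegral_mono fun x => ENNReal.ofReal_le_ofReal ?_) (pow n)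
  have e : Φ (c * ‖f x‖) = Φ (|c| * ‖f x‖) := by
    rcases abs_choice c with h | h
    · rw [h]
    · rw [h, neg_mul, Φ.even_toFun]
  rw [e]
  exact Φ.mono (by positivity) (by gcongr)

/-- For a `Δ₂`-regular Young function, bounded functions with compact support are dense in
`L^Φ`. -/
theorem OrliczSpace.exists_bounded_compactSupport_norm_sub_lt [T2Space G]
    [WeaklyLocallyCompactSpace G] [SigmaCompactSpace G] [OpensMeasurableSpace G]
    [IsFiniteMeasureOnCompacts lam] (hΦ : Φ.IsDelta2Regular G) (u : OrliczSpace Φ lam)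
    {ε : ℝ} (hε : 0 < ε) :
    ∃ (K : Set G) (C : ℝ) (f : G → ℂ) (hf : StronglyMeasurable f)
      (hm : MemOrlicz Φ lam f), IsCompact K ∧ (∀ x, ‖f x‖ ≤ C) ∧ (∀ x ∉ K, f x = 0) ∧
      ‖u - OrliczSpace.mk f hf.aestronglyMeasurable hm‖ < ε := by
  set g : G → ℂ := ⇑(u : G →ₘ[lam] ℂ)
  have hgm : StronglyMeasurable g := (u : G →ₘ[lam] ℂ).stronglyMeasurable
  let κ := CompactExhaustion.choice G
  -- Truncation in both domain and range. At each point the error eventually vanishes, and the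
  -- modular of `g` at scale `ε / 2`, finite by `Δ₂`, dominates.
  let A : ℕ → Set G := fun n => κ n ∩ {x | ‖g x‖ ≤ n}
  have hA : ∀ n, MeasurableSet (A n) := fun n =>
    (κ.isCompact n).measurableSet.inter (hgm.norm.measurable measurableSet_Iic)
  have hC : ∀ n x, ‖(A n).indicator g x‖ ≤ n := by
    intro n x
    by_cases hx : x ∈ A n
    · rw [Set.indicator_of_mem hx]; exact hx.2
    · rw [Set.indicator_of_notMem hx]; simp
  have h0 : ∀ n, ∀ x ∉ κ n, (A n).indicator g x = 0 := fun n x hx =>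
    Set.indicator_of_notMem (fun h => hx h.1) _
  have hmem : ∀ n, MemOrlicz Φ lam ((A n).indicator g) := fun n =>
    memOrlicz_of_bound (κ.isCompact n).measurableSet (κ.isCompact n).measure_ne_top (hC n) (h0 n)
  have hlim : Tendsto (fun n => ∫⁻ x, ENNReal.ofReal
      (Φ (‖g x - (A n).indicator g x‖ / (ε / 2))) ∂lam) atTop (𝓝 (∫⁻ _, 0 ∂lam)) := by
    refine tendsto_lintegral_of_dominated_convergence'
      (fun x => ENNReal.ofReal (Φ ((ε / 2)⁻¹ * ‖g x‖))) (fun n => ?_) (fun n => ?_)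
      (hΦ.lintegral_lt_top u.2 _).ne (ae_of_all _ fun x => ?_)
    · exact Φ.measurable_ofReal_comp
        ((hgm.sub (hgm.indicator (hA n))).norm.measurable.aemeasurable.div_const _)
    · refine ae_of_all _ fun x => ENNReal.ofReal_le_ofReal (Φ.mono (by positivity) ?_)
      rw [div_eq_inv_mul]
      gcongr
      by_cases hx : x ∈ A n
      · rw [Set.indicator_of_mem hx]; simp
      · rw [Set.indicator_of_notMem hx, sub_zero]
    · refine tendsto_const_nhds.congr' ?_
      obtain ⟨m, hm⟩ := κ.exists_mem x
      obtain ⟨l, hl⟩ := exists_nat_ge ‖g x‖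
      filter_upwards [eventually_ge_atTop (max m l)] with n hn
      have hx : x ∈ A n := ⟨κ.subset (le_of_max_le_left hn) hm,
        hl.trans (by exact_mod_cast le_of_max_le_right hn)⟩
      simp [Set.indicator_of_mem hx, Φ.map_zero']
  rw [lintegral_zero] at hlim
  -- A modular at most `1` at scale `ε / 2` already bounds the norm by `ε / 2`.
  obtain ⟨n, hn⟩ := (hlim.eventually (ge_mem_nhds one_pos)).exists
  refine ⟨κ n, n, (A n).indicator g, hgm.indicator (hA n), hmem n,
    κ.isCompact n, hC n, h0 n, ?_⟩
  rw [OrliczSpace.norm_eq_of_ae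
    (OrliczSpace.coeFn_sub_ae (EventuallyEq.refl _ g) (OrliczSpace.coeFn_mk _ _ _))]
  exact (luxemburgNorm_le_of_lintegral_le (half_pos hε) hn).trans_lt (half_lt_self hε)

end Density

/-! ### Iterates of the weighted translation -/

section Translation

variable {G : Type*} [Group G]

theorem weightProdInv_pos {w : G → ℝ} (hw : ∀ x, 0 < w x) (a : G) (n : ℕ) (x : G) :
    0 < weightProdInv w a n x :=
  inv_pos.2 (Finset.prod_pos fun _ _ => hw _)

theorem weightProd_pos {w : G → ℝ} (hw : ∀ x, 0 < w x) (a : G) (n : ℕ) (x : G) :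
    0 < weightProd w a n x :=
  Finset.prod_pos fun _ _ => hw _

/-- Both sides involve the same orbit points: `j ↦ n - j` matches `x a^(n-j)` for `0 ≤ j < n` with
`x a^j` for `1 ≤ j ≤ n`. -/
theorem weightProdInv_mul_pow (w : G → ℝ) (a : G) (n : ℕ) (x : G) :
    weightProdInv w a n (x * a ^ n) = (weightProd w a n x)⁻¹ := by
  rw [weightProdInv, weightProd]
  congr 1
  refine Finset.prod_nbij' (fun j => n - j) (fun j => n - j) ?_ ?_ ?_ ?_ fun j hj => ?_
  any_goals
    simp only [Finset.mem_range, Finset.mem_Icc]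
    omega
  have hj' : j ≤ n := (Finset.mem_range.1 hj).le
  simp only [convDirac]
  congr 1
  rw [inv_pow, inv_inv, mul_assoc, mul_right_inj, mul_inv_eq_iff_eq_mul, ← pow_add,
    Nat.sub_add_cancel hj']

/-- The cocycle relation behind the formula for iterates: the factor `j = 0` is split off and the
others are read from `x a⁻¹`. -/
theorem weightProdInv_succ_inv (w : G → ℝ) (a : G) (n : ℕ) (x : G) :
    (weightProdInv w a (n + 1) x)⁻¹ = w x * (weightProdInv w a n (x * a⁻¹))⁻¹ := by
  simp only [weightProdInv, inv_inv, Finset.prod_range_succ', convDirac, pow_zero, inv_one,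
    mul_one]
  rw [mul_comm]
  congr 1
  refine Finset.prod_congr rfl fun j _ => ?_
  rw [pow_succ, mul_inv_rev, mul_assoc]

variable [TopologicalSpace G] [IsTopologicalGroup G]

theorem continuous_weightProd {w : G → ℝ} (hw : Continuous w) (a : G) (n : ℕ) :
    Continuous (weightProd w a n) :=
  continuous_finsetProd _ fun _ _ => hw.comp (continuous_mul_const _)

theorem continuous_weightProdInv {w : G → ℝ} (hw : Continuous w) (hpos : ∀ x, 0 < w x) (a : G)
    (n : ℕ) : Continuous (weightProdInv w a n) :=
  (continuous_finsetProd _ fun _ _ => hw.comp (continuous_mul_const _)).inv₀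
    fun _ => (Finset.prod_pos fun _ _ => hpos _).ne'

variable [MeasurableSpace G] [BorelSpace G] {Φ : YoungFunction} {lam : Measure G}
  [lam.IsMulRightInvariant]

theorem ae_comp_mul_right {p : G → Prop} (h : ∀ᵐ x ∂lam, p x) (b : G) :
    ∀ᵐ x ∂lam, p (x * b) :=
  (measurePreserving_mul_right lam b).quasiMeasurePreserving.tendsto_ae.eventually h

theorem measure_preimage_mul_right_le (S : Set G) (b : G) :
    lam ((fun x => x * b) ⁻¹' S) ≤ lam S :=
  (measure_preimage_mul_right lam b S).le

theorem luxemburgNorm_comp_mul_right (f : G → ℂ) (b : G) :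
    luxemburgNorm Φ lam (fun x => f (x * b)) = luxemburgNorm Φ lam f := by
  unfold luxemburgNorm luxemburgSet
  congr 1
  ext k
  simp only [Set.mem_ofPred_eq]
  rw [lintegral_mul_right_eq_self (μ := lam) (fun x => ENNReal.ofReal (Φ (‖f x‖ / k))) b]

theorem MemOrlicz.comp_mul_right {f : G → ℂ} (hf : MemOrlicz Φ lam f) (b : G) :
    MemOrlicz Φ lam (fun x => f (x * b)) := by
  obtain ⟨c, hc, hI⟩ := hf
  refine ⟨c, hc, ?_⟩
  rwa [lintegral_mul_right_eq_self (μ := lam) (fun x => ENNReal.ofReal (Φ (c * ‖f x‖))) b]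

theorem coeFn_weightedTranslation_iterate (a : G) (w : GroupWeight G) (n : ℕ)
    {u : OrliczSpace Φ lam} {f : G → ℂ} (hu : (u : G →ₘ[lam] ℂ) =ᵐ[lam] f) :
    (((weightedTranslation Φ lam a w)^[n] u : OrliczSpace Φ lam) : G →ₘ[lam] ℂ) =ᵐ[lam]
      fun x => (((weightProdInv w a n x)⁻¹ : ℝ) : ℂ) * f (x * (a ^ n)⁻¹) := by
  induction n with
  | zero => simpa [weightProdInv] using hu
  | succ n ih =>
    rw [Function.iterate_succ_apply']
    refine (coeFn_weightedTranslationAEEqFun lam a w _).trans ?_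
    -- The induction hypothesis holds only almost everywhere and is needed at `x a⁻¹`; invariance of
    -- `lam` permits the shift.
    filter_upwards [ae_comp_mul_right ih a⁻¹] with x hx
    rw [convDirac, hx, weightProdInv_succ_inv]
    push_cast
    rw [mul_assoc (w x : ℂ), pow_succ, mul_inv_rev, mul_assoc x]

/-- Transporting by `a ^ n`, the iterate `T ^ n f` becomes multiplication by `φ_n`. -/
theorem norm_weightedTranslation_iterate (a : G) (w : GroupWeight G) (n : ℕ)
    {u : OrliczSpace Φ lam} {f : G → ℂ} (hu : (u : G →ₘ[lam] ℂ) =ᵐ[lam] f) :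
    ‖(weightedTranslation Φ lam a w)^[n] u‖ =
      luxemburgNorm Φ lam (fun x => (weightProd w a n x : ℂ) * f x) := by
  rw [OrliczSpace.norm_eq_of_ae (coeFn_weightedTranslation_iterate a w n hu),
    ← luxemburgNorm_comp_mul_right _ (a ^ n)]
  simp only [weightProdInv_mul_pow, inv_inv, mul_inv_cancel_right]

end Translation

/-! ### Mixing forces the weight products to be small -/

section Necessity

variable {G : Type*} [Group G] [TopologicalSpace G] [IsTopologicalGroup G] [T2Space G]
  [MeasurableSpace G] [BorelSpace G] {lam : Measure G} [lam.IsMulRightInvariant]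
  [IsFiniteMeasureOnCompacts lam] {Φ : YoungFunction} {a : G} {w : GroupWeight G} {K : Set G}

/-- Take `u` near the indicator of `K` with `T^n u` near `0`. At `x a^n` the iterate has modulus
`φ_n(x) |u(x)|`, which exceeds `δ / 2` wherever `|u(x)| > 1/2` and `φ_n(x) > δ`; each way of failing
costs measure at most `η / 2`. -/
theorem IsTopologicallyMixing.eventually_measure_weightProd_le
    (h : IsTopologicallyMixing (weightedTranslation Φ lam a w)) (hK : IsCompact K)
    {η : ℝ≥0∞} (hη : 0 < η) {δ : ℝ} (hδ : 0 < δ) :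
    ∀ᶠ n in atTop, lam {x | x ∈ K ∧ δ < weightProd w a n x} ≤ η := by
  obtain ⟨U, hU, hU', hUK⟩ := exists_nhds_indicator (μ := lam) Φ
    hK.measurableSet hK.measure_ne_top (ENNReal.half_pos hη.ne')
  obtain ⟨V, hV, hV', hVδ⟩ := exists_nhds_zero (μ := lam) Φ (ENNReal.half_pos hη.ne')
    (half_pos hδ)
  obtain ⟨N, hN⟩ := h U V hU hU' hV hV'
  filter_upwards [eventually_ge_atTop N] with n hn
  obtain ⟨_, ⟨u, hu, rfl⟩, hv⟩ := hN n hn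
  have hae := ae_comp_mul_right
    (coeFn_weightedTranslation_iterate a w n (EventuallyEq.refl _ ⇑(u : G →ₘ[lam] ℂ))) (a ^ n)
  rw [← ENNReal.add_halves η]
  refine le_trans ?_ (add_le_add (hUK u hu)
    ((measure_preimage_mul_right_le _ (a ^ n)).trans (hVδ _ hv)))
  refine (measure_mono_ae ?_).trans (measure_union_le _ _)
  filter_upwards [hae] with x hx hxK
  obtain ⟨hxK, hwx⟩ := hxK
  by_cases hux : ‖(u : G →ₘ[lam] ℂ) x‖ ≤ 1 / 2
  · exact Or.inl ⟨hxK, hux⟩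
  · refine Or.inr ?_
    show δ / 2 ≤ ‖_‖
    rw [hx, weightProdInv_mul_pow, inv_inv, mul_inv_cancel_right, norm_mul, Complex.norm_real,
      Real.norm_of_nonneg (weightProd_pos w.pos' a n x).le]
    push Not at hux
    nlinarith

/-- The roles are exchanged: `u` is near `0` and `T^n u` near the indicator of `K`. If `|T^n u (x)|
> 1/2` and `φ̃_n(x) > δ`, then `|u(x a⁻ⁿ)| > δ / 2`, which is rare. -/
theorem IsTopologicallyMixing.eventually_measure_weightProdInv_le
    (h : IsTopologicallyMixing (weightedTranslation Φ lam a w)) (hK : IsCompact K)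
    {η : ℝ≥0∞} (hη : 0 < η) {δ : ℝ} (hδ : 0 < δ) :
    ∀ᶠ n in atTop, lam {x | x ∈ K ∧ δ < weightProdInv w a n x} ≤ η := by
  obtain ⟨V, hV, hV', hVK⟩ := exists_nhds_indicator (μ := lam) Φ
    hK.measurableSet hK.measure_ne_top (ENNReal.half_pos hη.ne')
  obtain ⟨U, hU, hU', hUδ⟩ := exists_nhds_zero (μ := lam) Φ (ENNReal.half_pos hη.ne')
    (half_pos hδ)
  obtain ⟨N, hN⟩ := h U V hU hU' hV hV'
  filter_upwards [eventually_ge_atTop N] with n hn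
  obtain ⟨_, ⟨u, hu, rfl⟩, hv⟩ := hN n hn
  have hae := coeFn_weightedTranslation_iterate a w n (EventuallyEq.refl _ ⇑(u : G →ₘ[lam] ℂ))
  rw [← ENNReal.add_halves η]
  refine le_trans ?_ (add_le_add (hVK _ hv)
    ((measure_preimage_mul_right_le _ (a ^ n)⁻¹).trans (hUδ u hu)))
  refine (measure_mono_ae ?_).trans (measure_union_le _ _)
  filter_upwards [hae] with x hx hxK
  obtain ⟨hxK, hwx⟩ := hxK
  refine or_iff_not_imp_left.2 fun hne => ?_
  have hux : ¬ _ ≤ (1 / 2 : ℝ) := fun h' => hne ⟨hxK, h'⟩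
  have hpos := weightProdInv_pos w.pos' a n x
  rw [hx, norm_mul, Complex.norm_real, norm_inv, Real.norm_of_nonneg hpos.le, not_le,
    ← div_eq_inv_mul, lt_div_iff₀ hpos] at hux
  show δ / 2 ≤ ‖_‖
  linarith

theorem IsTopologicallyMixing.exists_sets
    (h : IsTopologicallyMixing (weightedTranslation Φ lam a w)) (hK : IsCompact K) :
    ∃ E : ℕ → Set G, (∀ n, MeasurableSet (E n) ∧ E n ⊆ K) ∧
      Tendsto (fun n => lam (E n)) atTop (𝓝 (lam K)) ∧
      Tendsto (fun n => supNormOn (weightProd w a n) (E n)) atTop (𝓝 0) ∧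
      Tendsto (fun n => supNormOn (weightProdInv w a n) (E n)) atTop (𝓝 0) := by
  -- `δ m` serves both as threshold for the two products and as bound for the measure lost to each.
  let δ : ℕ → ℝ := fun m => 1 / ((m : ℝ) + 1)
  have hδ0 : ∀ m, 0 < δ m := fun m => Nat.one_div_pos_of_nat
  have hδ : Tendsto (fun m => ENNReal.ofReal (δ m)) atTop (𝓝 0) := by
    rw [← ENNReal.ofReal_zero]
    exact ENNReal.tendsto_ofReal tendsto_one_div_add_atTop_nhds_zero_nat
  let E : ℕ → ℕ → Set G := fun n m =>
    K ∩ ({x | weightProd w a n x ≤ δ m} ∩ {x | weightProdInv w a n x ≤ δ m})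
  have hEm : ∀ n m, MeasurableSet (E n m) := fun n m => hK.measurableSet.inter
    ((isClosed_le (continuous_weightProd w.continuous_toFun a n) continuous_const).inter
      (isClosed_le (continuous_weightProdInv w.continuous_toFun w.pos' a n)
        continuous_const)).measurableSet
  have hE : ∀ m, ∀ᶠ n in atTop,
      lam K ≤ lam (E n m) + (ENNReal.ofReal (δ m) + ENNReal.ofReal (δ m)) := by
    intro m
    have hp := ENNReal.ofReal_pos.2 (hδ0 m)
    filter_upwards [h.eventually_measure_weightProd_le hK hp (hδ0 m),
      h.eventually_measure_weightProdInv_le hK hp (hδ0 m)] with n h1 h2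
    refine le_trans ?_ (add_le_add le_rfl (add_le_add h1 h2))
    refine (measure_mono fun x hx => ?_).trans
      ((measure_union_le _ _).trans (add_le_add le_rfl (measure_union_le _ _)))
    by_cases hx1 : weightProd w a n x ≤ δ m
    · by_cases hx2 : weightProdInv w a n x ≤ δ m
      · exact Or.inl ⟨hx, hx1, hx2⟩
      · exact Or.inr (Or.inr ⟨hx, not_le.1 hx2⟩)
    · exact Or.inr (Or.inl ⟨hx, not_le.1 hx1⟩)
  -- The level `m` may grow with `n`, slowly enough for the measure estimate to survive.
  obtain ⟨k, hk, hkE⟩ := Filter.exists_tendsto_of_forall_eventually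
    (P := fun n m => lam K ≤ lam (E n m) + (ENNReal.ofReal (δ m) + ENNReal.ofReal (δ m))) hE
  have hδk := hδ.comp hk
  refine ⟨fun n => E n (k n), fun n => ⟨hEm _ _, Set.inter_subset_left⟩, ?_, ?_, ?_⟩
  · have hlow : Tendsto (fun n => lam K -
        (ENNReal.ofReal (δ (k n)) + ENNReal.ofReal (δ (k n)))) atTop (𝓝 (lam K)) := by
      have := ENNReal.Tendsto.sub (tendsto_const_nhds (x := lam K)) (hδk.add hδk)
        (Or.inl hK.measure_ne_top)
      simpa using this
    refine tendsto_of_tendsto_of_tendsto_of_le_of_le' hlow tendsto_const_nhds ?_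
      (Eventually.of_forall fun n => measure_mono Set.inter_subset_left)
    filter_upwards [hkE] with n hn
    exact tsub_le_iff_right.2 hn
  · refine tendsto_of_tendsto_of_tendsto_of_le_of_le tendsto_const_nhds hδk
      (fun _ => zero_le) fun n => iSup₂_le fun x hx => ?_
    rw [Real.enorm_of_nonneg (weightProd_pos w.pos' a n x).le]
    exact ENNReal.ofReal_le_ofReal hx.2.1
  · refine tendsto_of_tendsto_of_tendsto_of_le_of_le tendsto_const_nhds hδk
      (fun _ => zero_le) fun n => iSup₂_le fun x hx => ?_
    rw [Real.enorm_of_nonneg (weightProdInv_pos w.pos' a n x).le]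
    exact ENNReal.ofReal_le_ofReal hx.2.2

end Necessity

/-! ### Small weight products imply mixing -/

section Sufficiency

theorem le_of_supNormOn_le {X : Type*} {h : X → ℝ} {E : Set X} {δ : ℝ} (hδ : 0 ≤ δ)
    (hE : supNormOn h E ≤ ENNReal.ofReal δ) {x : X} (hx : x ∈ E) : h x ≤ δ := by
  have h1 : ‖h x‖ₑ ≤ ENNReal.ofReal δ := (le_iSup₂ (f := fun x _ => ‖h x‖ₑ) x hx).trans hE
  rw [← ofReal_norm, ENNReal.ofReal_le_ofReal_iff hδ] at h1
  exact (Real.le_norm_self _).trans h1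

variable {α : Type*} [MeasurableSpace α] {Φ : YoungFunction} {μ : Measure α}

/-- The difference is bounded by `C` and supported on `K \ E n`, whose measure tends to `0` because
`K` has finite measure. -/
theorem eventually_luxemburgNorm_sub_indicator_lt {K : Set α} (hK : MeasurableSet K)
    (hμ : μ K ≠ ∞) {E : ℕ → Set α} (hE : ∀ n, MeasurableSet (E n) ∧ E n ⊆ K)
    (hlim : Tendsto (fun n => μ (E n)) atTop (𝓝 (μ K))) {f : α → ℂ} {C : ℝ}
    (hC : ∀ x, ‖f x‖ ≤ C) (h0 : ∀ x ∉ K, f x = 0) {ε : ℝ} (hε : 0 < ε) :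
    ∀ᶠ n in atTop, luxemburgNorm Φ μ (fun x => f x - (E n).indicator f x) < ε := by
  have h1 : Tendsto (fun n => μ (K \ E n)) atTop (𝓝 0) := by
    have := ENNReal.Tendsto.sub (tendsto_const_nhds (x := μ K)) hlim (Or.inl hμ)
    rw [tsub_self] at this
    refine this.congr fun n => ?_
    rw [measure_sdiff (hE n).2 (hE n).1.nullMeasurableSet (measure_ne_top_of_subset (hE n).2 hμ)]
  have h2 := ENNReal.Tendsto.const_mul (a := ENNReal.ofReal (Φ ((ε / 2)⁻¹ * C))) h1
    (Or.inr ENNReal.ofReal_ne_top)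
  rw [mul_zero] at h2
  filter_upwards [h2.eventually (ge_mem_nhds one_pos)] with n hn
  refine (luxemburgNorm_le_of_bound (half_pos hε) (hK.diff (hE n).1) (fun x => ?_)
    (fun x hx => ?_) hn).trans_lt (half_lt_self hε)
  · by_cases hx : x ∈ E n
    · simpa [Set.indicator_of_mem hx] using (norm_nonneg _).trans (hC x)
    · simpa [Set.indicator_of_notMem hx] using hC x
  · by_cases hxE : x ∈ E n
    · simp [Set.indicator_of_mem hxE]
    · rw [Set.indicator_of_notMem hxE, h0 x fun h => hx ⟨h, hxE⟩, sub_zero]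

variable {G : Type*} [Group G] [TopologicalSpace G] [IsTopologicalGroup G]
  [MeasurableSpace G] [BorelSpace G] {lam : Measure G} [lam.IsMulRightInvariant]
  {a : G} {w : GroupWeight G}

/-- A function on a set where `φ̃_n ≤ δ` has a preimage under `T ^ n` of norm at most `δ` times
its own. -/
theorem exists_iterate_eq_of_weightProdInv_le (n : ℕ) {g : G → ℂ}
    (hgm : StronglyMeasurable g) (hg : MemOrlicz Φ lam g) {δ : ℝ} (hδ : 0 ≤ δ)
    (hE : ∀ x, g x ≠ 0 → weightProdInv w a n x ≤ δ) :
    ∃ v : OrliczSpace Φ lam, ‖v‖ ≤ δ * luxemburgNorm Φ lam g ∧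
      (((weightedTranslation Φ lam a w)^[n] v : OrliczSpace Φ lam) : G →ₘ[lam] ℂ)
        =ᵐ[lam] g := by
  -- The preimage is the shift of `q` by `a^n`: `T^n` shifts back and divides by `φ̃_n`, which
  -- cancels the factor exactly.
  let q : G → ℂ := fun x => (weightProdInv w a n x : ℂ) * g x
  have hq : ∀ x, ‖q x‖ ≤ δ * ‖g x‖ := by
    intro x
    rw [norm_mul, Complex.norm_real, Real.norm_of_nonneg (weightProdInv_pos w.pos' a n x).le]
    by_cases hx : g x = 0
    · simp [hx]
    · gcongr
      exact hE x hx
  have hqm : StronglyMeasurable q := (Complex.continuous_ofReal.comp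
    (continuous_weightProdInv w.continuous_toFun w.pos' a n)).measurable.mul
      hgm.measurable |>.stronglyMeasurable
  have hqO : MemOrlicz Φ lam q := (hg.const_mul (δ : ℂ)).of_norm_le <| ae_of_all _ fun x => by
    rw [norm_mul (δ : ℂ), Complex.norm_real, Real.norm_of_nonneg hδ]; exact hq x
  have hqn : luxemburgNorm Φ lam q ≤ δ * luxemburgNorm Φ lam g :=
    luxemburgNorm_le_mul hg hδ (ae_of_all _ hq)
  have hvm : AEStronglyMeasurable (fun x => q (x * a ^ n)) lam :=
    (hqm.comp_measurable (measurable_mul_const _)).aestronglyMeasurable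
  refine ⟨OrliczSpace.mk (fun x => q (x * a ^ n)) hvm (hqO.comp_mul_right _), ?_, ?_⟩
  · rw [OrliczSpace.norm_eq_of_ae (OrliczSpace.coeFn_mk _ _ _), luxemburgNorm_comp_mul_right]
    exact hqn
  · refine (coeFn_weightedTranslation_iterate a w n (OrliczSpace.coeFn_mk _ _ _)).trans
      (Eventually.of_forall fun x => ?_)
    have hpos := weightProdInv_pos w.pos' a n x
    have hne : (weightProdInv w a n x : ℂ) ≠ 0 := by exact_mod_cast hpos.ne'
    simp only [q, inv_mul_cancel_right]
    push_cast
    rw [inv_mul_cancel_left₀ hne]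

theorem norm_iterate_le_of_weightProd_le (n : ℕ) {u : OrliczSpace Φ lam} {f : G → ℂ}
    (hu : (u : G →ₘ[lam] ℂ) =ᵐ[lam] f) (hf : MemOrlicz Φ lam f) {δ : ℝ} (hδ : 0 ≤ δ)
    (hE : ∀ x, f x ≠ 0 → weightProd w a n x ≤ δ) :
    ‖(weightedTranslation Φ lam a w)^[n] u‖ ≤ δ * luxemburgNorm Φ lam f := by
  rw [norm_weightedTranslation_iterate a w n hu]
  refine luxemburgNorm_le_mul hf hδ (ae_of_all _ fun x => ?_)
  rw [norm_mul, Complex.norm_real, Real.norm_of_nonneg (weightProd_pos w.pos' a n x).le]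
  by_cases hx : f x = 0
  · simp [hx]
  · gcongr
    exact hE x hx

theorem isTopologicallyMixing_of_exists_sets [T2Space G] [LocallyCompactSpace G]
    [SigmaCompactSpace G] [IsFiniteMeasureOnCompacts lam] [lam.IsOpenPosMeasure]
    (hΦ : Φ.IsDelta2Regular G)
    (h : ∀ K : Set G, IsCompact K → 0 < lam K →
      ∃ E : ℕ → Set G, (∀ n, MeasurableSet (E n) ∧ E n ⊆ K) ∧
        Tendsto (fun n => lam (E n)) atTop (𝓝 (lam K)) ∧
        Tendsto (fun n => supNormOn (weightProd w a n) (E n)) atTop (𝓝 0) ∧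
        Tendsto (fun n => supNormOn (weightProdInv w a n) (E n)) atTop (𝓝 0)) :
    IsTopologicallyMixing (weightedTranslation Φ lam a w) := by
  rintro U V hU ⟨u₀, hu₀⟩ hV ⟨v₀, hv₀⟩
  obtain ⟨r, hr, hrU⟩ := Metric.isOpen_iff.1 hU u₀ hu₀
  obtain ⟨s, hs, hsV⟩ := Metric.isOpen_iff.1 hV v₀ hv₀
  obtain ⟨K₁, C, f, hf, hfO, hK₁, hfC, hf0, hfu⟩ :=
    OrliczSpace.exists_bounded_compactSupport_norm_sub_lt hΦ u₀ (by positivity : 0 < r / 3)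
  obtain ⟨K₂, D, g, hg, hgO, hK₂, hgD, hg0, hgv⟩ :=
    OrliczSpace.exists_bounded_compactSupport_norm_sub_lt hΦ v₀ (by positivity : 0 < s / 3)
  -- `K₁` and `K₂` may be null; a compact neighbourhood of `1` is added so that `K` has positive
  -- measure.
  obtain ⟨K₃, hK₃, hK₃1⟩ := exists_compact_mem_nhds (1 : G)
  set K := K₁ ∪ (K₂ ∪ K₃)
  have hK : IsCompact K := hK₁.union (hK₂.union hK₃)
  have hKpos : 0 < lam K := (Measure.measure_pos_of_mem_nhds lam hK₃1).trans_le
    (measure_mono fun x hx => Or.inr (Or.inr hx))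
  obtain ⟨E, hE, hElim, hE1, hE2⟩ := h K hK hKpos
  -- The radii are crossed: `T^n u`, built from `f`, is an error in `V`, while `v`, built from `g`,
  -- is an error in `U`.
  obtain ⟨δ₁, hδ₁, hδf⟩ := exists_pos_mul_lt (by positivity : 0 < s / 3) (luxemburgNorm Φ lam f)
  obtain ⟨δ₂, hδ₂, hδg⟩ := exists_pos_mul_lt (by positivity : 0 < r / 3) (luxemburgNorm Φ lam g)
  refine eventually_atTop.1 ?_
  filter_upwards [hE1.eventually (ge_mem_nhds (ENNReal.ofReal_pos.2 hδ₁)),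
    hE2.eventually (ge_mem_nhds (ENNReal.ofReal_pos.2 hδ₂)),
    eventually_luxemburgNorm_sub_indicator_lt (Φ := Φ) hK.measurableSet hK.measure_ne_top hE
      hElim hfC (fun x hx => hf0 x fun h => hx (Or.inl h)) (by positivity : 0 < r / 3),
    eventually_luxemburgNorm_sub_indicator_lt (Φ := Φ) hK.measurableSet hK.measure_ne_top hE
      hElim hgD (fun x hx => hg0 x fun h => hx (Or.inr (Or.inl h)))
      (by positivity : 0 < s / 3)] with n h1 h2 h3 h4
  have hind : ∀ q : G → ℂ, ∀ᵐ x ∂lam, ‖(E n).indicator q x‖ ≤ ‖q x‖ := fun q =>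
    ae_of_all _ fun x => norm_indicator_le_norm_self q x
  have hsupp : ∀ {q : G → ℂ} {x : G}, (E n).indicator q x ≠ 0 → x ∈ E n :=
    fun hx => Set.mem_of_indicator_ne_zero hx
  have hfO' := hfO.of_norm_le (hind f)
  have hgO' := hgO.of_norm_le (hind g)
  let u : OrliczSpace Φ lam :=
    OrliczSpace.mk _ (hf.indicator (hE n).1).aestronglyMeasurable hfO'
  have hu : (u : G →ₘ[lam] ℂ) =ᵐ[lam] (E n).indicator f := OrliczSpace.coeFn_mk _ _ _
  obtain ⟨v, hv, hTv⟩ := exists_iterate_eq_of_weightProdInv_le (a := a) (w := w) n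
    (hg.indicator (hE n).1) hgO' hδ₂.le fun x hx => le_of_supNormOn_le hδ₂.le h2 (hsupp hx)
  have hTu := norm_iterate_le_of_weightProd_le (a := a) (w := w) n hu hfO' hδ₁.le
    fun x hx => le_of_supNormOn_le hδ₁.le h1 (hsupp hx)
  replace hv : ‖v‖ < r / 3 := by
    refine hv.trans_lt (lt_of_le_of_lt ?_ hδg)
    rw [mul_comm]
    gcongr
    exact luxemburgNorm_mono hgO (hind g)
  replace hTu : ‖(weightedTranslation Φ lam a w)^[n] u‖ < s / 3 := by
    refine hTu.trans_lt (lt_of_le_of_lt ?_ hδf)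
    rw [mul_comm]
    gcongr
    exact luxemburgNorm_mono hfO (hind f)
  rw [← OrliczSpace.norm_eq_of_ae (OrliczSpace.coeFn_sub_ae
    (OrliczSpace.coeFn_mk f hf.aestronglyMeasurable hfO) hu)] at h3
  rw [← OrliczSpace.norm_eq_of_ae (OrliczSpace.coeFn_sub_ae
    (OrliczSpace.coeFn_mk g hg.aestronglyMeasurable hgO) hTv)] at h4
  refine ⟨_, ⟨u + v, hrU ?_, rfl⟩, hsV ?_⟩
  · rw [mem_ball_iff_norm']
    -- Three errors, each below a third of the radius: approximation by `f`, cutting down to `E n`,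
    -- and the correction `v`.
    have e : u₀ - (u + v) = (u₀ - OrliczSpace.mk f hf.aestronglyMeasurable hfO) +
        (OrliczSpace.mk f hf.aestronglyMeasurable hfO - u) - v := by abel
    rw [e]
    refine (norm_sub_le _ _).trans_lt ?_
    linarith [norm_add_le (u₀ - OrliczSpace.mk f hf.aestronglyMeasurable hfO)
      (OrliczSpace.mk f hf.aestronglyMeasurable hfO - u)]
  · rw [mem_ball_iff_norm', iterate_map_add]
    have e : v₀ - ((weightedTranslation Φ lam a w)^[n] u +
        (weightedTranslation Φ lam a w)^[n] v) =
        (v₀ - OrliczSpace.mk g hg.aestronglyMeasurable hgO) +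
        (OrliczSpace.mk g hg.aestronglyMeasurable hgO -
          (weightedTranslation Φ lam a w)^[n] v) - (weightedTranslation Φ lam a w)^[n] u := by
      abel
    rw [e]
    refine (norm_sub_le _ _).trans_lt ?_
    linarith [norm_add_le (v₀ - OrliczSpace.mk g hg.aestronglyMeasurable hgO)
      (OrliczSpace.mk g hg.aestronglyMeasurable hgO - (weightedTranslation Φ lam a w)^[n] v)]

end Sufficiency

theorem corollary2p7 {G : Type*} [Group G] [TopologicalSpace G] [IsTopologicalGroup G]
    [LocallyCompactSpace G] [T2Space G] [SecondCountableTopology G]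
    [MeasurableSpace G] [BorelSpace G]
    -- `lam` is a right Haar measure on `G`
    (lam : Measure G) [lam.IsMulRightInvariant] [IsFiniteMeasureOnCompacts lam]
    [lam.IsOpenPosMeasure]
    (Φ : YoungFunction) (hΦ : Φ.IsDelta2Regular G)
    (a : G) (ha : IsAperiodic a)
    (w : GroupWeight G) (hw : MemLp (fun x => (w x)⁻¹) ∞ lam) :
    IsTopologicallyMixing (weightedTranslation Φ lam a w) ↔
      ∀ K : Set G, IsCompact K → 0 < lam K →
        ∃ E : ℕ → Set G, (∀ n, MeasurableSet (E n) ∧ E n ⊆ K) ∧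
          Tendsto (fun n => lam (E n)) atTop (𝓝 (lam K)) ∧
          Tendsto (fun n => supNormOn (weightProd w a n) (E n)) atTop (𝓝 0) ∧
          Tendsto (fun n => supNormOn (weightProdInv w a n) (E n)) atTop (𝓝 0) :=
  ⟨fun h _ hK _ => h.exists_sets hK, isTopologicallyMixing_of_exists_sets hΦ⟩
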